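/- There exist absolute constants $\eta\in(0,1]$, $c>0$ and $N\in\mathbb N$ such that the following holds for all $n\ge N$, all $p$, and every vector $\beta^*\in\mathbb R^p$. Let $S=\{j:\beta^*_j\neq 0\}$ and $s=|S|$, and suppose that $n>c\,s^4$. Let $X$ be a random matrix that is uniformly distributed on the Stiefel manifold $V(n,p)=\{V\in\mathbb R^{n\times p}: VV^T=I_n\}$, that is, $X$ takes values in $V(n,p)$ almost surely and $XO$ has the same distribution as $X$ for every fixed orthogonal $p\times p$ matrix $O$ (so that necessarily $p\ge n$). Let $\tilde X$ be the column-normalized version of $X$, $\tilde X_{ij}=X_{ij}/\sqrt{\sum_{k=1}^n X_{kj}^2}$. Then, with probability at least $$1-4p^2\exp(-n^{1/2}),$$ $\tilde X$ satisfies the irrepresentable condition for $\beta^*$ with constant $\eta$: the matrix $\tilde X(S)^T\tilde X(S)$ is invertible and $$\left\|\tilde X(S^c)^T\tilde X(S)\left(\tilde X(S)^T\tilde X(S)\right)^{-1}\mathrm{sign}(\beta^*(S))\right\|_\infty\le 1-\eta,$$ where $\tilde X(T)$ is the submatrix of the columns of $\tilde X$ indexed by $T$, $\beta^*(S)=(\beta^*_j)_{j\in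 S}$, and $\mathrm{sign}$ is taken entrywise. -/

import Mathlib

open MeasureTheory ProbabilityTheory Matrix

noncomputable section

/-- Matrices carry the product (equivalently, Borel) σ-algebra. -/
instance matrixMeasurableSpace (n p : ℕ) : MeasurableSpace (Matrix (Fin n) (Fin p) ℝ) :=
  inferInstanceAs (MeasurableSpace (Fin n → Fin p → ℝ))

/-- The Stiefel manifold `V(n, p)` of real `n × p` matrices `V` with `V Vᵀ = Iₙ`
(it is empty when `p < n`). -/
def stiefel (n p : ℕ) : Set (Matrix (Fin n) (Fin p) ℝ) :=
  {V | V * Vᵀ = 1}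

/-- The random matrix `X` on the probability space `(Ω, P)` is uniformly distributed on
`V(n, p)`: it takes its values in `V(n, p)` almost surely, and `X O` has the same law as `X`
for every fixed orthogonal matrix `O`. -/
structure IsUniformOnStiefel {Ω : Type*} [MeasurableSpace Ω] {n p : ℕ}
    (X : Ω → Matrix (Fin n) (Fin p) ℝ) (P : Measure Ω) : Prop where
  aemeasurable : AEMeasurable X P
  ae_mem : ∀ᵐ ω ∂P, X ω ∈ stiefel n p
  map_mul_orthogonal : ∀ O ∈ Matrix.orthogonalGroup (Fin p) ℝ,
    P.map (fun ω => X ω * O) = P.map X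

/-- The column-normalized version of `X`: entry `(i, j)` is `X i j / √(∑ k, X k j ^ 2)`. -/
def normalizeColumns {n p : ℕ} (X : Matrix (Fin n) (Fin p) ℝ) : Matrix (Fin n) (Fin p) ℝ :=
  Matrix.of fun i j => X i j / √(∑ k, X k j ^ 2)

/-- The submatrix `X(T)` formed by the columns of `X` with index in `T`. -/
def columns {n p : ℕ} (X : Matrix (Fin n) (Fin p) ℝ) (T : Finset (Fin p)) :
    Matrix (Fin n) T ℝ :=
  X.submatrix id (fun j : T => (j : Fin p))

/-- The set `S` of relevant predictors, i.e. the support of the coefficient vector. -/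
def relevant {p : ℕ} (β : Fin p → ℝ) : Finset (Fin p) :=
  Finset.univ.filter fun j => β j ≠ 0

/-- The irrepresentable condition for `β` with constant `η`:
`‖X(Sᶜ)ᵀ X(S) (X(S)ᵀ X(S))⁻¹ sign(β(S))‖_∞ ≤ 1 - η`, where `S` is the support of `β`.
The invertibility of `X(S)ᵀ X(S)`, which the formula presupposes, is part of the condition.
The norm of a function on a finite type is the maximum norm. -/
def IrrepresentableCondition {n p : ℕ} (η : ℝ) (X : Matrix (Fin n) (Fin p) ℝ)
    (β : Fin p → ℝ) : Prop :=
  IsUnit ((columns X (relevant β))ᵀ * columns X (relevant β)).det ∧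
    ‖((columns X (relevant β)ᶜ)ᵀ * columns X (relevant β) *
        ((columns X (relevant β))ᵀ * columns X (relevant β))⁻¹) *ᵥ
          (fun j : relevant β => Real.sign (β j))‖ ≤ 1 - η

end

/-!
The Gram matrix `Xᵀ X` is a random projection of rank `n` in `ℝᵖ`, and its entries are governed by
the lengths `‖X u‖²` for `u = e i ± e j`, through polarization. For a fixed `u ≠ 0` the invariance
of the law of `X` under orthogonal matrices shows that the law of `‖X u‖² / ‖u‖²` does not depend on
`u` (`IsUniformOnStiefel.map_distorts_eq`). Hence `u` may be replaced by a standard Gaussian vector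
`g` independent of `X`, and by Fubini's theorem it is enough to treat a fixed `V` with orthonormal
rows. In an orthonormal basis that extends these rows, `‖V g‖²` and `‖g‖²` are chi-square variables
with `n` and `p ≥ n` degrees of freedom, so Chernoff's bound (`measure_sum_sq_sub_one_ge_le`) gives
`‖X u‖² / ‖u‖² = (1 ± ε) n / p` outside an event of probability `4 exp (-n ε² / 72)`
(`IsUniformOnStiefel.measureReal_distorts_le`).

A union bound over the `p²` vectors `u` makes all normalized inner products of distinct columns at
most `2 ε` in absolute value (`coherence_normalizeColumns_le`). With `ε = 9 n ^ (-1 / 4)` the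
failure probability is at most `4 p² exp (-√n)`, and since `n > c s⁴` the coherence is a small
multiple of `1 / s`. Diagonal dominance of the Gram matrix of the relevant columns then yields the
irrepresentable condition (`irrepresentableCondition_of_coherence_le`).
-/

/-! ### Chi-square tails -/

lemma integral_exp_mul_sq_sub_one_gaussianReal {t : ℝ} (ht : t < 1 / 2) :
    ∫ x, Real.exp (t * (x ^ 2 - 1)) ∂(gaussianReal 0 1) =
      Real.exp (-t) * √(1 / (1 - 2 * t)) := by
  have hfun : ∀ x : ℝ, gaussianPDFReal 0 1 x • Real.exp (t * (x ^ 2 - 1)) =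
      ((√(2 * Real.pi))⁻¹ * Real.exp (-t)) * Real.exp (-(1 / 2 - t) * x ^ 2) := by
    intro x
    simp only [gaussianPDFReal_def, smul_eq_mul, NNReal.coe_one, mul_one, sub_zero]
    rw [mul_assoc, mul_assoc, ← Real.exp_add, ← Real.exp_add]
    ring_nf
  rw [integral_gaussianReal_eq_integral_smul one_ne_zero]
  simp_rw [hfun]
  rw [integral_const_mul, integral_gaussian, mul_comm (√(2 * Real.pi))⁻¹, mul_assoc,
    ← Real.sqrt_inv, ← Real.sqrt_mul (by positivity)]
  have h : 1 - 2 * t ≠ 0 := by linarith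
  have h' : 1 / 2 - t ≠ 0 := by linarith
  congr 2
  field_simp

/-- The centred square of a standard Gaussian is sub-exponential. -/
lemma integral_exp_mul_sq_sub_one_gaussianReal_le {t : ℝ} (ht : |t| ≤ 1 / 4) :
    ∫ x, Real.exp (t * (x ^ 2 - 1)) ∂(gaussianReal 0 1) ≤ Real.exp (2 * t ^ 2) := by
  obtain ⟨h1, h2⟩ := abs_le.1 ht
  rw [integral_exp_mul_sq_sub_one_gaussianReal (by linarith)]
  have hpos : 0 < 1 - 2 * t := by linarith
  -- This is `-log (1 - y) ≤ y + y ^ 2` for `|y| ≤ 1 / 2`, with `y = 2 * t`.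
  have key : 1 / (1 - 2 * t) ≤ Real.exp (2 * t + 4 * t ^ 2) := by
    rw [one_div, inv_le_iff_one_le_mul₀ hpos]
    rcases le_total 0 t with h0 | h0
    · have := Real.quadratic_le_exp_of_nonneg (x := 2 * t + 4 * t ^ 2) (by positivity)
      have h3 : 1 ≤ (1 + (2 * t + 4 * t ^ 2) + (2 * t + 4 * t ^ 2) ^ 2 / 2) * (1 - 2 * t) := by
        have : 0 ≤ t ^ 2 * (2 - 4 * t - 8 * t ^ 2) :=
          mul_nonneg (sq_nonneg _) (by nlinarith)
        nlinarith [mul_nonneg (sq_nonneg t) (sq_nonneg t), mul_nonneg (sq_nonneg t) h0,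
          mul_nonneg (sq_nonneg t) (mul_nonneg h0 hpos.le),
          mul_nonneg (mul_nonneg (sq_nonneg t) (sq_nonneg t)) hpos.le]
      nlinarith
    · have := Real.add_one_le_exp (2 * t + 4 * t ^ 2)
      have h3 : 1 ≤ (2 * t + 4 * t ^ 2 + 1) * (1 - 2 * t) := by
        nlinarith [mul_nonneg (sq_nonneg t) (neg_nonneg.2 h0)]
      nlinarith
  calc Real.exp (-t) * √(1 / (1 - 2 * t)) ≤ Real.exp (-t) * √(Real.exp (2 * t + 4 * t ^ 2)) := by
        gcongr
    _ = Real.exp (2 * t ^ 2) := by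
        rw [← Real.exp_half, ← Real.exp_add]
        ring_nf

lemma integrable_exp_mul_sq_sub_one_gaussianReal {t : ℝ} (ht : t < 1 / 2) :
    Integrable (fun x => Real.exp (t * (x ^ 2 - 1))) (gaussianReal 0 1) := by
  -- A function that is not integrable has integral `0`, but the integral here is positive.
  by_contra h
  have h1 := integral_exp_mul_sq_sub_one_gaussianReal ht
  rw [integral_undef h] at h1
  have : 0 < 1 - 2 * t := by linarith
  have : 0 < Real.exp (-t) * √(1 / (1 - 2 * t)) := by positivity
  linarith

/-- Chernoff bound for both tails of a chi-square variable with `#T` degrees of freedom; the sign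
of `a` selects the tail. -/
lemma measure_sum_sq_sub_one_ge_le {ι : Type*} [Fintype ι] (T : Finset ι) {a δ : ℝ}
    (ha : |a| = 1) (hδ : 0 ≤ δ) (hδ1 : δ ≤ 1) :
    (Measure.pi fun _ : ι => gaussianReal 0 1).real
        {x | T.card * δ ≤ a * ∑ i ∈ T, (x i ^ 2 - 1)} ≤ Real.exp (-(T.card * δ ^ 2 / 8)) := by
  classical
  set t : ℝ := δ / 4 * a
  have htabs : |t| = δ / 4 := by rw [abs_mul, ha, mul_one, abs_of_nonneg (by positivity)]
  have ht : |t| ≤ 1 / 4 := by linarith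
  have ht2 : t < 1 / 2 := by linarith [le_abs_self t]
  have hsq : t ^ 2 = δ ^ 2 / 16 := by rw [← sq_abs, htabs]; ring
  let f : ι → ℝ → ℝ := fun i x => if i ∈ T then Real.exp (t * (x ^ 2 - 1)) else 1
  have hf : ∀ x : ι → ℝ, Real.exp (δ / 4 * (a * ∑ i ∈ T, (x i ^ 2 - 1))) = ∏ i, f i (x i) := by
    intro x
    rw [← mul_assoc, Finset.mul_sum, Real.exp_sum, Finset.prod_ite_mem, Finset.univ_inter]
  have hint : Integrable (fun x : ι → ℝ => ∏ i, f i (x i))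
      (Measure.pi fun _ : ι => gaussianReal 0 1) := by
    refine Integrable.fintype_prod fun i => ?_
    by_cases hi : i ∈ T
    · simpa only [f, hi, if_true] using integrable_exp_mul_sq_sub_one_gaussianReal ht2
    · simp only [f, hi, if_false]
      exact integrable_const _
  have hval : ∫ x : ι → ℝ, ∏ i, f i (x i) ∂(Measure.pi fun _ : ι => gaussianReal 0 1) ≤
      Real.exp (T.card * (δ ^ 2 / 8)) := by
    rw [integral_fintype_prod_eq_prod (fun i => f i)]
    have h1 : ∀ i, ∫ x, f i x ∂(gaussianReal 0 1) =
        if i ∈ T then ∫ x, Real.exp (t * (x ^ 2 - 1)) ∂(gaussianReal 0 1) else 1 := by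
      intro i
      by_cases hi : i ∈ T <;> simp [f, hi]
    simp_rw [h1]
    rw [Finset.prod_ite_mem, Finset.univ_inter, Finset.prod_const, Real.exp_nat_mul]
    refine pow_le_pow_left₀ (integral_nonneg fun _ => (Real.exp_pos _).le) ?_ _
    refine (integral_exp_mul_sq_sub_one_gaussianReal_le ht).trans_eq ?_
    rw [hsq]
    ring_nf
  have hm := measure_ge_le_exp_mul_mgf (μ := Measure.pi fun _ : ι => gaussianReal 0 1)
    (X := fun x : ι → ℝ => a * ∑ i ∈ T, (x i ^ 2 - 1)) (t := δ / 4) (T.card * δ)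
    (by positivity) (by simp_rw [hf]; exact hint)
  refine hm.trans ?_
  simp only [mgf, hf]
  refine (mul_le_mul_of_nonneg_left hval (Real.exp_pos _).le).trans_eq ?_
  rw [← Real.exp_add]
  ring_nf

/-! ### Distortion of lengths by a matrix -/

/-- `A` distorts `u` by the relative amount `ε`: the value of `‖A u‖² / ‖u‖²` is not strictly
between `(1 - ε) n / p` and `(1 + ε) n / p`. The inequalities are cleared of denominators, so that
the condition is homogeneous in `u` and holds for `u = 0`. -/
def Distorts {n p : ℕ} (ε : ℝ) (A : Matrix (Fin n) (Fin p) ℝ) (u : Fin p → ℝ) : Prop :=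
  ¬((1 - ε) * n * (u ⬝ᵥ u) < p * ((A *ᵥ u) ⬝ᵥ (A *ᵥ u)) ∧
    p * ((A *ᵥ u) ⬝ᵥ (A *ᵥ u)) < (1 + ε) * n * (u ⬝ᵥ u))

lemma distorts_zero {n p : ℕ} (ε : ℝ) (A : Matrix (Fin n) (Fin p) ℝ) : Distorts ε A 0 := by
  simp [Distorts]

lemma distorts_smul_iff {n p : ℕ} (ε : ℝ) (A : Matrix (Fin n) (Fin p) ℝ) (u : Fin p → ℝ)
    {r : ℝ} (hr : r ≠ 0) : Distorts ε A (r • u) ↔ Distorts ε A u := by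
  have hr2 : 0 < r ^ 2 := by positivity
  have e1 : ∀ a b : ℝ, a * n * (r * (r * b)) = r ^ 2 * (a * n * b) := fun a b => by ring
  have e2 : ∀ b : ℝ, (p : ℝ) * (r * (r * b)) = r ^ 2 * (p * b) := fun b => by ring
  simp only [Distorts, mulVec_smul, smul_dotProduct, dotProduct_smul, smul_eq_mul, e1, e2,
    mul_lt_mul_iff_right₀ hr2]

lemma measurable_matrix_apply {n p : ℕ} (i : Fin n) (j : Fin p) :
    Measurable fun A : Matrix (Fin n) (Fin p) ℝ => A i j :=
  (measurable_pi_apply j).comp (measurable_pi_apply (X := fun _ : Fin n => Fin p → ℝ) i)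

lemma measurable_matrix_mul_const {n p : ℕ} (O : Matrix (Fin p) (Fin p) ℝ) :
    Measurable fun A : Matrix (Fin n) (Fin p) ℝ => A * O := by
  refine measurable_pi_lambda (X := fun _ : Fin n => Fin p → ℝ) _ fun i =>
    measurable_pi_lambda _ fun j => ?_
  simp only [Matrix.mul_apply]
  exact Finset.measurable_sum _ fun k _ => (measurable_matrix_apply i k).mul_const _

lemma measurableSet_distorts {n p : ℕ} (ε : ℝ) :
    MeasurableSet {q : Matrix (Fin n) (Fin p) ℝ × (Fin p → ℝ) | Distorts ε q.1 q.2} := by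
  have h1 : Measurable fun q : Matrix (Fin n) (Fin p) ℝ × (Fin p → ℝ) => q.2 ⬝ᵥ q.2 := by
    simp only [dotProduct]
    fun_prop
  have h2 : Measurable fun q : Matrix (Fin n) (Fin p) ℝ × (Fin p → ℝ) =>
      (q.1 *ᵥ q.2) ⬝ᵥ (q.1 *ᵥ q.2) := by
    simp only [dotProduct, mulVec]
    have h3 : ∀ i, Measurable fun q : Matrix (Fin n) (Fin p) ℝ × (Fin p → ℝ) =>
        ∑ j, q.1 i j * q.2 j := fun i => Finset.measurable_sum _ fun j _ =>
      ((measurable_matrix_apply i j).comp measurable_fst).mul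
        ((measurable_pi_apply j).comp measurable_snd)
    exact Finset.measurable_sum _ fun i _ => (h3 i).mul (h3 i)
  exact ((measurableSet_lt (h1.const_mul _) (h2.const_mul _)).inter
    (measurableSet_lt (h2.const_mul _) (h1.const_mul _))).compl

lemma measurableSet_distorts_left {n p : ℕ} (ε : ℝ) (u : Fin p → ℝ) :
    MeasurableSet {A : Matrix (Fin n) (Fin p) ℝ | Distorts ε A u} :=
  (measurable_id.prodMk measurable_const) (measurableSet_distorts ε)

lemma measurableSet_distorts_right {n p : ℕ} (ε : ℝ) (A : Matrix (Fin n) (Fin p) ℝ) :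
    MeasurableSet {u | Distorts ε A u} :=
  (measurable_const.prodMk measurable_id) (measurableSet_distorts ε)

/-! ### Gaussian vectors and fixed orthonormal rows -/

/-- The rows of `V` are orthonormal; in an orthonormal basis of `ℝᵖ` extending them, a standard
Gaussian vector has independent standard Gaussian coordinates, the first `n` of which form `V g`. -/
lemma exists_measurePreserving_of_mem_stiefel {n p : ℕ} {V : Matrix (Fin n) (Fin p) ℝ}
    (hV : V ∈ stiefel n p) :
    ∃ (T : Finset (Fin p)) (φ : (Fin p → ℝ) → (Fin p → ℝ)), T.card = n ∧
      MeasurePreserving φ (Measure.pi fun _ => gaussianReal 0 1)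
        (Measure.pi fun _ => gaussianReal 0 1) ∧
      (∀ x, φ x ⬝ᵥ φ x = ∑ i, x i ^ 2) ∧
      ∀ x, (V *ᵥ φ x) ⬝ᵥ (V *ᵥ φ x) = ∑ i ∈ T, x i ^ 2 := by
  classical
  have hVV : ∀ k l, V k ⬝ᵥ V l = if k = l then 1 else 0 := by
    intro k l
    have := congrFun (congrFun (show V * Vᵀ = 1 from hV) k) l
    rwa [Matrix.one_apply] at this
  let r : Fin n → EuclideanSpace ℝ (Fin p) := fun k => WithLp.toLp 2 (V k)
  have hr : Orthonormal ℝ r := by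
    rw [orthonormal_iff_ite]
    intro k l
    rw [← hVV k l, dotProduct_comm]
    simp [r, PiLp.inner_apply, dotProduct, mul_comm]
  have hnp : n ≤ p := by
    simpa using hr.linearIndependent.fintype_card_le_finrank
  let c : Fin n → Fin p := Fin.castLE hnp
  have hc : Function.Injective c := Fin.castLE_injective hnp
  let v : Fin p → EuclideanSpace ℝ (Fin p) := fun i => if h : (i : ℕ) < n then r ⟨i, h⟩ else 0
  have hv : Orthonormal ℝ (({i : Fin p | (i : ℕ) < n} : Set (Fin p)).domRestrict v) := by
    have : ({i : Fin p | (i : ℕ) < n} : Set (Fin p)).domRestrict v =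
        r ∘ fun i => ⟨i.1, i.2⟩ := by
      funext i
      have hi : ((i : Fin p) : ℕ) < n := i.2
      simp [v, hi]
    rw [this]
    refine hr.comp _ fun i j hij => ?_
    simpa [Fin.ext_iff, Subtype.ext_iff] using hij
  obtain ⟨b, hb⟩ := hv.exists_orthonormalBasis_extension_of_card_eq (by simp)
  have hbc : ∀ k, b (c k) = r k := by
    intro k
    rw [hb _ (by simp [c])]
    simp [v, c]
  let ψ : (Fin p → ℝ) → EuclideanSpace ℝ (Fin p) := fun x => ∑ i, x i • b i
  have hψ : Measurable ψ := by fun_prop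
  have hψr : ∀ x i, b.repr (ψ x) i = x i := by
    intro x i
    have := congrArg (fun y => y i) (b.repr.apply_symm_apply (WithLp.toLp 2 x))
    simpa only [← b.sum_repr_symm] using this
  refine ⟨Finset.univ.image c, fun x => WithLp.ofLp (ψ x), ?_, ⟨by fun_prop, ?_⟩, ?_, ?_⟩
  · rw [Finset.card_image_of_injective _ hc, Finset.card_univ, Fintype.card_fin]
  · have h1 := stdGaussian_eq_map_pi_orthonormalBasis b
    rw [← map_pi_eq_stdGaussian] at h1
    have h2 := congrArg (Measure.map (WithLp.ofLp : EuclideanSpace ℝ (Fin p) → Fin p → ℝ)) h1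
    rw [Measure.map_map (by fun_prop) (by fun_prop), Measure.map_map (by fun_prop) hψ] at h2
    refine h2.symm.trans ?_
    exact Measure.map_id
  · intro x
    have h1 : ‖b.repr (ψ x)‖ ^ 2 = ‖ψ x‖ ^ 2 := by rw [LinearIsometryEquiv.norm_map]
    simp only [EuclideanSpace.norm_sq_eq, hψr, Real.norm_eq_abs, sq_abs] at h1
    simp only [dotProduct, ← pow_two, h1]
  · intro x
    rw [Finset.sum_image hc.injOn]
    refine Finset.sum_congr rfl fun k _ => ?_
    have h1 : (V *ᵥ WithLp.ofLp (ψ x)) k = x (c k) := by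
      rw [← hψr x (c k), OrthonormalBasis.repr_apply_apply, hbc]
      simp [r, PiLp.inner_apply, mulVec, dotProduct, mul_comm]
    rw [h1, pow_two]

/-- The ratio `‖V g‖² / ‖g‖²` is distorted only if one of the two chi-square variables `‖V g‖²` and
`‖g‖²` deviates from its mean, `n` and `p` respectively, by a relative amount `ε / 3`. -/
lemma measure_distorts_le_of_mem_stiefel {n p : ℕ} {V : Matrix (Fin n) (Fin p) ℝ}
    (hV : V ∈ stiefel n p) (hn : 0 < n) {ε : ℝ} (hε : 0 < ε) (hε1 : ε ≤ 1) :
    (Measure.pi fun _ : Fin p => gaussianReal 0 1) {u | Distorts ε V u} ≤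
      ENNReal.ofReal (4 * Real.exp (-(n * ε ^ 2 / 72))) := by
  obtain ⟨T, φ, hT, hφ, hφ1, hφ2⟩ := exists_measurePreserving_of_mem_stiefel hV
  set γ := Measure.pi fun _ : Fin p => gaussianReal 0 1
  have hnp : n ≤ p := by simpa [hT] using Finset.card_le_univ T
  have hn' : (0 : ℝ) < n := by exact_mod_cast hn
  have hnp' : (n : ℝ) ≤ p := by exact_mod_cast hnp
  rw [← hφ.measure_preimage (measurableSet_distorts_right ε V).nullMeasurableSet]
  let D : Finset (Fin p) → ℝ → Set (Fin p → ℝ) :=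
    fun S a => {x | S.card * (ε / 3) ≤ a * ∑ i ∈ S, (x i ^ 2 - 1)}
  have hD : ∀ (S : Finset (Fin p)) (a : ℝ), n ≤ S.card → |a| = 1 →
      γ.real (D S a) ≤ Real.exp (-(n * ε ^ 2 / 72)) := by
    intro S a hS ha
    refine (measure_sum_sq_sub_one_ge_le S ha (by positivity) (by linarith)).trans ?_
    have hS' : (n : ℝ) ≤ S.card := by exact_mod_cast hS
    rw [Real.exp_le_exp]
    nlinarith [mul_le_mul_of_nonneg_right hS' (sq_nonneg ε)]
  have hsub : φ ⁻¹' {u | Distorts ε V u} ⊆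
      (D T 1 ∪ D T (-1)) ∪ (D Finset.univ 1 ∪ D Finset.univ (-1)) := by
    intro x hx
    by_contra hcon
    simp only [D, Set.mem_union, Set.mem_ofPred_eq, not_or, not_le, hT, Finset.card_univ,
      Fintype.card_fin, Finset.sum_sub_distrib, Finset.sum_const, nsmul_eq_mul, mul_one,
      one_mul] at hcon
    obtain ⟨⟨h1, h2⟩, h3, h4⟩ := hcon
    refine hx ?_
    rw [hφ1, hφ2]
    have hp' : (0 : ℝ) < p := by linarith
    set a := ∑ i ∈ T, x i ^ 2
    set b := ∑ i, x i ^ 2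
    have ha1 : a < (1 + ε / 3) * n := by linarith
    have ha2 : (1 - ε / 3) * n < a := by linarith
    have hb1 : b < (1 + ε / 3) * p := by linarith
    have hb2 : (1 - ε / 3) * p < b := by linarith
    have hpn : (0 : ℝ) < p * n := by positivity
    constructor
    · calc (1 - ε) * n * b ≤ (1 - ε) * n * ((1 + ε / 3) * p) := by
            refine mul_le_mul_of_nonneg_left hb1.le (mul_nonneg (by linarith) hn'.le)
        _ ≤ p * ((1 - ε / 3) * n) := by nlinarith [mul_pos hpn hε, mul_pos (mul_pos hpn hε) hε]
        _ < p * a := by gcongr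
    · calc p * a < p * ((1 + ε / 3) * n) := by gcongr
        _ ≤ (1 + ε) * n * ((1 - ε / 3) * p) := by
            nlinarith [mul_nonneg (mul_pos hpn hε).le (sub_nonneg.2 hε1)]
        _ ≤ (1 + ε) * n * b := by gcongr
  refine (measure_mono hsub).trans ?_
  rw [← ofReal_measureReal]
  refine ENNReal.ofReal_le_ofReal ?_
  have hu : n ≤ (Finset.univ : Finset (Fin p)).card := by simpa using hnp
  have e1 := measureReal_union_le (μ := γ) (D T 1 ∪ D T (-1)) (D Finset.univ 1 ∪ D Finset.univ (-1))
  have e2 := measureReal_union_le (μ := γ) (D T 1) (D T (-1))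
  have e3 := measureReal_union_le (μ := γ) (D Finset.univ 1) (D Finset.univ (-1))
  have a1 : |(1 : ℝ)| = 1 := abs_one
  have a2 : |(-1 : ℝ)| = 1 := by simp
  linarith [hD T 1 hT.ge a1, hD T (-1) hT.ge a2, hD _ 1 hu a1, hD _ (-1) hu a2]

/-! ### Orthogonal invariance -/

/-- Vectors of equal length are exchanged by a Householder reflection. -/
lemma exists_orthogonal_mulVec_eq {p : ℕ} {u w : Fin p → ℝ} (h : u ⬝ᵥ u = w ⬝ᵥ w) :
    ∃ O ∈ Matrix.orthogonalGroup (Fin p) ℝ, O *ᵥ u = w := by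
  by_cases huw : u = w
  · exact ⟨1, one_mem _, by rw [one_mulVec, huw]⟩
  set z := u - w
  have hz : z ⬝ᵥ z ≠ 0 := by
    rw [Ne, dotProduct_self_eq_zero]
    exact sub_ne_zero.2 huw
  have hzu : 2 * (z ⬝ᵥ u) = z ⬝ᵥ z := by
    simp only [z, sub_dotProduct, dotProduct_sub, ← h, dotProduct_comm w u]
    ring
  refine ⟨1 - (2 / (z ⬝ᵥ z)) • vecMulVec z z, ?_, ?_⟩
  · rw [Matrix.mem_orthogonalGroup_iff]
    have hs : (1 - (2 / (z ⬝ᵥ z)) • vecMulVec z z)ᵀ = 1 - (2 / (z ⬝ᵥ z)) • vecMulVec z z := by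
      rw [transpose_sub, transpose_one, transpose_smul, transpose_vecMulVec]
    have hzz : vecMulVec z z * vecMulVec z z = (z ⬝ᵥ z) • vecMulVec z z := by
      rw [vecMulVec_mul_vecMulVec]
      ext i j
      simp [vecMulVec_apply]
      ring
    rw [hs, sub_mul, mul_sub, mul_sub, one_mul, one_mul, mul_one, smul_mul_smul_comm, hzz,
      smul_smul]
    have : 2 / (z ⬝ᵥ z) * (2 / (z ⬝ᵥ z)) * (z ⬝ᵥ z) = 2 / (z ⬝ᵥ z) + 2 / (z ⬝ᵥ z) := by
      field_simp
      norm_num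
    rw [this, add_smul]
    abel
  · rw [sub_mulVec, one_mulVec, smul_mulVec, vecMulVec_mulVec]
    ext i
    have : 2 / (z ⬝ᵥ z) * (z ⬝ᵥ u) = 1 := by
      rw [div_mul_eq_mul_div, hzu, div_self hz]
    simp [z] at this ⊢
    linear_combination (-(u i - w i)) * this

section Uniform

variable {Ω : Type*} [MeasurableSpace Ω] {P : Measure Ω} {n p : ℕ}
  {X : Ω → Matrix (Fin n) (Fin p) ℝ}

/-- The orthogonal invariance makes the law of the distortion independent of the direction. -/
lemma IsUniformOnStiefel.map_distorts_eq (hX : IsUniformOnStiefel X P) (ε : ℝ)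
    {u w : Fin p → ℝ} (hu : u ≠ 0) (hw : w ≠ 0) :
    P.map X {A | Distorts ε A u} = P.map X {A | Distorts ε A w} := by
  have hu0 : 0 < u ⬝ᵥ u := by
    simpa using (dotProduct_star_self_pos_iff (v := u)).2 hu
  have hw0 : 0 < w ⬝ᵥ w := by
    simpa using (dotProduct_star_self_pos_iff (v := w)).2 hw
  set r : ℝ := √((w ⬝ᵥ w) / (u ⬝ᵥ u))
  have hr : 0 < r := by positivity
  have hr2 : r * r = (w ⬝ᵥ w) / (u ⬝ᵥ u) := Real.mul_self_sqrt (by positivity)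
  have hru : (r • u) ⬝ᵥ (r • u) = w ⬝ᵥ w := by
    rw [smul_dotProduct, dotProduct_smul, smul_eq_mul, smul_eq_mul, ← mul_assoc, hr2]
    field_simp
  obtain ⟨O, hO, hOw⟩ := exists_orthogonal_mulVec_eq hru
  have hmeas := measurable_matrix_mul_const (n := n) O
  have hmap : (P.map X).map (fun A => A * O) = P.map X := by
    rw [AEMeasurable.map_map_of_aemeasurable hmeas.aemeasurable hX.aemeasurable]
    exact hX.map_mul_orthogonal O hO
  have hset : {A : Matrix (Fin n) (Fin p) ℝ | Distorts ε A w} =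
      (fun A => A * O) ⁻¹' {A | Distorts ε A u} := by
    ext A
    refine Iff.trans ?_ (distorts_smul_iff ε (A * O) u hr.ne')
    simp only [Set.mem_ofPred_eq, Distorts, ← mulVec_mulVec, hOw, hru]
  rw [hset, ← Measure.map_apply hmeas (measurableSet_distorts_left ε u), hmap]

/-- Concentration of `‖X u‖² / ‖u‖²` for a fixed vector `u`: since its law does not depend on `u`,
the vector may be replaced by an independent Gaussian one, and by Fubini's theorem the bound for
fixed orthonormal rows and a Gaussian vector applies. -/
lemma IsUniformOnStiefel.measureReal_distorts_le [IsProbabilityMeasure P]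
    (hX : IsUniformOnStiefel X P) (hn : 0 < n) {ε : ℝ} (hε : 0 < ε) (hε1 : ε ≤ 1)
    {u : Fin p → ℝ} (hu : u ≠ 0) :
    P.real {ω | Distorts ε (X ω) u} ≤ 4 * Real.exp (-(n * ε ^ 2 / 72)) := by
  set γ := Measure.pi fun _ : Fin p => gaussianReal 0 1
  have : IsProbabilityMeasure (P.map X) := Measure.isProbabilityMeasure_map hX.aemeasurable
  have hle : ∀ w : Fin p → ℝ, P.map X {A | Distorts ε A u} ≤ P.map X {A | Distorts ε A w} := by
    intro w
    by_cases hw : w = 0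
    -- The zero vector counts as distorted.
    · simp only [hw, distorts_zero]
      exact measure_mono fun _ _ => trivial
    · exact (hX.map_distorts_eq ε hu hw).le
  have hS := measurableSet_distorts (n := n) (p := p) ε
  have key : P.map X {A | Distorts ε A u} ≤
      ENNReal.ofReal (4 * Real.exp (-(n * ε ^ 2 / 72))) :=
    calc P.map X {A | Distorts ε A u} = ∫⁻ _, P.map X {A | Distorts ε A u} ∂γ := by simp
      _ ≤ ∫⁻ w, P.map X {A | Distorts ε A w} ∂γ := lintegral_mono hle
      _ = ((P.map X).prod γ) {q | Distorts ε q.1 q.2} := (Measure.prod_apply_symm hS).symm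
      _ = ∫⁻ A, γ {w | Distorts ε A w} ∂(P.map X) := Measure.prod_apply hS
      _ ≤ ∫⁻ _, ENNReal.ofReal (4 * Real.exp (-(n * ε ^ 2 / 72))) ∂(P.map X) := by
          refine (lintegral_map_le _ _).trans ?_
          refine (lintegral_mono_ae (hX.ae_mem.mono fun ω hω =>
            measure_distorts_le_of_mem_stiefel hω hn hε hε1)).trans_eq ?_
          simp
      _ = ENNReal.ofReal (4 * Real.exp (-(n * ε ^ 2 / 72))) := by simp
  rw [Measure.map_apply_of_aemeasurable hX.aemeasurable (measurableSet_distorts_left ε u)] at key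
  exact ENNReal.toReal_le_of_le_ofReal (by positivity) key

end Uniform

/-! ### Coherence and the irrepresentable condition -/

lemma sum_normalizeColumns_mul {n p : ℕ} (A : Matrix (Fin n) (Fin p) ℝ) (i j : Fin p) :
    ∑ k, normalizeColumns A k i * normalizeColumns A k j =
      (∑ k, A k i * A k j) / (√(∑ k, A k i ^ 2) * √(∑ k, A k j ^ 2)) := by
  simp only [normalizeColumns, Matrix.of_apply, Finset.sum_div]
  exact Finset.sum_congr rfl fun k _ => div_mul_div_comm _ _ _ _

/-- A matrix with columns of unit length and pairwise coherence at most `μ` satisfies the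
irrepresentable condition once `s μ ≤ 1 / 4`: the Gram matrix of the relevant columns is diagonally
dominant, and its inverse is bounded by `4 / 3` in the maximum norm. -/
lemma irrepresentableCondition_of_coherence_le {n p : ℕ} {Y : Matrix (Fin n) (Fin p) ℝ}
    {β : Fin p → ℝ} {μ : ℝ} (hμ : 0 ≤ μ) (hdiag : ∀ i, ∑ k, Y k i * Y k i = 1)
    (hoff : ∀ i j, i ≠ j → |∑ k, Y k i * Y k j| ≤ μ)
    (hs : (relevant β).card * μ ≤ 1 / 4) : IrrepresentableCondition (1 / 2) Y β := by
  classical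
  set S := relevant β
  set G := (columns Y S)ᵀ * columns Y S
  have hG : ∀ i j, G i j = ∑ k, Y k i * Y k j := fun i j => rfl
  have hrow : ∀ i : S, ∀ w : S → ℝ, ∀ M : ℝ, (∀ j, |w j| ≤ M) → 0 ≤ M →
      |∑ j ∈ Finset.univ.erase i, G i j * w j| ≤ 1 / 4 * M := by
    intro i w M hw hM
    calc |∑ j ∈ Finset.univ.erase i, G i j * w j|
        ≤ ∑ j ∈ Finset.univ.erase i, |G i j * w j| := Finset.abs_sum_le_sum_abs _ _
      _ ≤ ∑ j ∈ Finset.univ.erase i, μ * M := by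
          refine Finset.sum_le_sum fun j hj => ?_
          rw [abs_mul]
          refine mul_le_mul ?_ (hw j) (abs_nonneg _) hμ
          rw [hG]
          exact hoff _ _ fun h => (Finset.ne_of_mem_erase hj) (Subtype.ext h.symm)
      _ ≤ ∑ j : S, μ * M := Finset.sum_le_sum_of_subset_of_nonneg (Finset.subset_univ _)
          fun _ _ _ => mul_nonneg hμ hM
      _ = S.card * μ * M := by simp [mul_assoc]
      _ ≤ 1 / 4 * M := mul_le_mul_of_nonneg_right hs hM
  have hdet : IsUnit G.det := by
    refine (det_ne_zero_of_sum_row_lt_diag fun i => ?_).isUnit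
    calc ∑ j ∈ Finset.univ.erase i, ‖G i j‖ ≤ ∑ j ∈ Finset.univ.erase i, μ := by
          refine Finset.sum_le_sum fun j hj => ?_
          rw [hG]
          exact hoff _ _ fun h => (Finset.ne_of_mem_erase hj) (Subtype.ext h.symm)
      _ ≤ ∑ j : S, μ := Finset.sum_le_sum_of_subset_of_nonneg (Finset.subset_univ _)
          fun _ _ _ => hμ
      _ = S.card * μ := by simp
      _ < ‖G i i‖ := by rw [hG, hdiag, norm_one]; linarith
  refine ⟨hdet, ?_⟩
  set σ : S → ℝ := fun j => Real.sign (β j)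
  have hσ : ∀ j, |σ j| ≤ 1 := by
    intro j
    rcases Real.sign_apply_eq (β j) with h | h | h <;> simp [σ, h]
  set w := G⁻¹ *ᵥ σ
  have hGw : G *ᵥ w = σ := by rw [mulVec_mulVec, mul_nonsing_inv _ hdet, one_mulVec]
  have hwj : ∀ j, |w j| ≤ ‖w‖ := fun j => norm_le_pi_norm w j
  -- Read `G w = σ` in each row: the diagonal term is `w i`.
  have hw : ‖w‖ ≤ 1 + 1 / 4 * ‖w‖ := by
    refine (pi_norm_le_iff_of_nonneg (by positivity)).2 fun i => ?_
    have h1 : ∑ j, G i j * w j = σ i := congrFun hGw i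
    rw [← Finset.add_sum_erase _ _ (Finset.mem_univ i), hG, hdiag, one_mul] at h1
    have h2 : w i = σ i - ∑ j ∈ Finset.univ.erase i, G i j * w j := by linarith
    rw [Real.norm_eq_abs, h2]
    exact (abs_sub _ _).trans (add_le_add (hσ i) (hrow i w _ hwj (norm_nonneg _)))
  rw [← mulVec_mulVec]
  refine (pi_norm_le_iff_of_nonneg (by norm_num)).2 fun i => ?_
  calc ‖(((columns Y Sᶜ)ᵀ * columns Y S) *ᵥ w) i‖
      ≤ ∑ j, |((columns Y Sᶜ)ᵀ * columns Y S) i j * w j| := by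
        rw [Real.norm_eq_abs, mulVec, dotProduct]
        exact Finset.abs_sum_le_sum_abs _ _
    _ ≤ ∑ j : S, μ * ‖w‖ := by
        refine Finset.sum_le_sum fun j _ => ?_
        rw [abs_mul]
        refine mul_le_mul (hoff _ _ fun h => ?_) (hwj j) (abs_nonneg _) hμ
        have hj : ((j : Fin p)) ∈ S := j.2
        rw [← show (i : Fin p) = j from h] at hj
        exact Finset.mem_compl.1 i.2 hj
    _ = S.card * μ * ‖w‖ := by simp [mul_assoc]
    _ ≤ 1 / 4 * ‖w‖ := mul_le_mul_of_nonneg_right hs (norm_nonneg _)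
    _ ≤ 1 - 1 / 2 := by linarith

/-- The directions whose distortion controls the Gram matrix through the polarization identity:
`e i + e j` for `i ≤ j` (so `2 e i` for `i = j`), and `e i - e j` for `j < i`. -/
def polarizationVector {p : ℕ} (q : Fin p × Fin p) : Fin p → ℝ :=
  if q.1 ≤ q.2 then Pi.single q.1 1 + Pi.single q.2 1 else Pi.single q.1 1 - Pi.single q.2 1

lemma polarizationVector_ne_zero {p : ℕ} (q : Fin p × Fin p) : polarizationVector q ≠ 0 := by
  obtain ⟨i, j⟩ := q
  intro h
  have h1 := congrFun h i
  by_cases hij : i = j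
  · subst hij
    simp [polarizationVector] at h1
  · by_cases hle : i ≤ j <;> simp [polarizationVector, hle, hij] at h1

/-- By polarization, `p ⟪A i, A j⟫` is at most `ε n` for distinct columns, while `p ‖A i‖²` is at
least `(1 - ε) n`; the quotient is at most `ε / (1 - ε) ≤ 2 ε`. -/
lemma coherence_normalizeColumns_le {n p : ℕ} {A : Matrix (Fin n) (Fin p) ℝ} {ε : ℝ}
    (hn : 0 < n) (hε : 0 < ε) (hε1 : ε ≤ 1 / 2)
    (hA : ∀ q, ¬Distorts ε A (polarizationVector q)) :
    (∀ i, ∑ k, normalizeColumns A k i * normalizeColumns A k i = 1) ∧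
      ∀ i j, i ≠ j → |∑ k, normalizeColumns A k i * normalizeColumns A k j| ≤ 2 * ε := by
  have hn' : (0 : ℝ) < n := by exact_mod_cast hn
  have hmv : ∀ i, A *ᵥ Pi.single i 1 = A.col i := fun i => mulVec_single_one A i
  have hcol : ∀ i j, A.col i ⬝ᵥ A.col j = ∑ k, A k i * A k j := fun i j => rfl
  have hd : ∀ i : Fin p, (1 - ε) * n < p * ∑ k, A k i ^ 2 := by
    intro i
    have h := not_not.1 (hA (i, i))
    simp only [polarizationVector, le_refl, if_true, mulVec_add, hmv, add_dotProduct,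
      dotProduct_add, hcol] at h
    simp at h
    simp only [pow_two]
    linarith [h.1]
  have hpos : ∀ i : Fin p, (0 : ℝ) < ∑ k, A k i ^ 2 := by
    intro i
    have h1 : 0 < (1 - ε) * (n : ℝ) := mul_pos (by linarith) hn'
    exact pos_of_mul_pos_right (h1.trans (hd i)) (Nat.cast_nonneg _)
  have hlt : ∀ i j : Fin p, i < j → |p * ∑ k, A k i * A k j| ≤ ε * n := by
    intro i j hij
    have h1 := not_not.1 (hA (i, j))
    have h2 := not_not.1 (hA (j, i))
    have hcomm : ∑ k, A k j * A k i = ∑ k, A k i * A k j :=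
      Finset.sum_congr rfl fun k _ => mul_comm _ _
    simp only [polarizationVector, hij.le, hij.not_ge, if_true, if_false, mulVec_add, mulVec_sub,
      hmv, add_dotProduct, dotProduct_add, sub_dotProduct, dotProduct_sub, hcol, hcomm] at h1 h2
    simp [hij.ne, hij.ne'] at h1 h2
    rw [abs_le]
    constructor <;> linarith [h1.1, h1.2, h2.1, h2.2]
  constructor
  · intro i
    rw [sum_normalizeColumns_mul, Real.mul_self_sqrt (hpos i).le]
    simp only [← pow_two]
    exact div_self (hpos i).ne'
  · have hmain : ∀ i j, i < j →
        |∑ k, normalizeColumns A k i * normalizeColumns A k j| ≤ 2 * ε := by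
      intro i j hij
      have hp : (0 : ℝ) < p := by exact_mod_cast i.pos
      have hi := hpos i
      have hj := hpos j
      have h1 := hlt i j hij
      rw [abs_mul, abs_of_pos hp] at h1
      rw [sum_normalizeColumns_mul, ← Real.sqrt_mul hi.le, abs_div,
        abs_of_nonneg (Real.sqrt_nonneg _), div_le_iff₀ (Real.sqrt_pos.2 (mul_pos hi hj))]
      have hm : (1 - ε) * n / p ≤ √((∑ k, A k i ^ 2) * ∑ k, A k j ^ 2) := by
        have h0 : 0 ≤ (1 - ε) * n / p := div_nonneg (mul_nonneg (by linarith) hn'.le) hp.le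
        refine Real.le_sqrt_of_sq_le ?_
        rw [pow_two]
        refine mul_le_mul ?_ ?_ h0 hi.le
        · rw [div_le_iff₀' hp]; exact (hd i).le
        · rw [div_le_iff₀' hp]; exact (hd j).le
      refine le_trans ?_ (mul_le_mul_of_nonneg_left hm (by positivity))
      rw [← mul_div_assoc, le_div_iff₀' hp]
      nlinarith [mul_pos hε hn']
    intro i j hij
    rcases lt_or_gt_of_ne hij with h | h
    · exact hmain i j h
    · simpa only [mul_comm] using hmain j i h

theorem theorem2 :
    ∃ η : ℝ, 0 < η ∧ η ≤ 1 ∧ ∃ c : ℝ, 0 < c ∧ ∃ N : ℕ,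
      ∀ n : ℕ, N ≤ n → ∀ (p : ℕ) (β : Fin p → ℝ),
        c * ((relevant β).card : ℝ) ^ 4 < (n : ℝ) →
        ∀ (Ω : Type*) [MeasurableSpace Ω] (P : Measure Ω) [IsProbabilityMeasure P]
          (X : Ω → Matrix (Fin n) (Fin p) ℝ),
          IsUniformOnStiefel X P →
          1 - 4 * (p : ℝ) ^ 2 * Real.exp (-(n : ℝ) ^ (1 / 2 : ℝ)) ≤
            P.real {ω | IrrepresentableCondition η (normalizeColumns (X ω)) β} := by
  refine ⟨1 / 2, by norm_num, by norm_num, 72 ^ 4, by norm_num, 18 ^ 4, ?_⟩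
  intro n hN p β hs Ω _ P _ X hX
  have hn : 0 < n := lt_of_lt_of_le (by norm_num) hN
  have hn' : (0 : ℝ) < n := by exact_mod_cast hn
  have hN' : (18 : ℝ) ^ 4 ≤ n := by exact_mod_cast hN
  -- `ε` is chosen such that `n * ε ^ 2 / 72` is at least `√n`, while `s * (2 * ε) ≤ 1 / 4`.
  set a : ℝ := √(√n)
  have ha2 : a ^ 2 = √n := Real.sq_sqrt (Real.sqrt_nonneg _)
  have ha4 : a ^ 4 = n := by
    rw [show a ^ 4 = (a ^ 2) ^ 2 by ring, ha2, Real.sq_sqrt hn'.le]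
  have ha : 0 < a := by positivity
  have ha18 : 18 ≤ a := by
    refine le_of_pow_le_pow_left₀ four_ne_zero ha.le ?_
    rwa [ha4]
  have hs' : 72 * ((relevant β).card : ℝ) ≤ a := by
    refine le_of_pow_le_pow_left₀ four_ne_zero ha.le ?_
    rw [ha4, mul_pow]
    exact hs.le
  set ε : ℝ := 9 / a
  have hε : 0 < ε := by positivity
  have hε1 : ε ≤ 1 / 2 := by
    rw [div_le_iff₀ ha]
    linarith
  have hexp : Real.exp (-(n * ε ^ 2 / 72)) ≤ Real.exp (-(n : ℝ) ^ (1 / 2 : ℝ)) := by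
    rw [Real.exp_le_exp, ← Real.sqrt_eq_rpow, ← ha2, neg_le_neg_iff, ← ha4]
    have : a ^ 4 * (9 / a) ^ 2 / 72 = 81 / 72 * a ^ 2 := by
      field_simp
      norm_num
    rw [this]
    nlinarith [sq_nonneg a]
  have hcoh : (relevant β).card * (2 * ε) ≤ 1 / 4 := by
    have : (relevant β).card * (2 * ε) = (72 * (relevant β).card) / a / 4 := by
      simp only [ε]
      ring
    rw [this]
    have := (div_le_one ha).2 hs'
    linarith
  set I := {ω | IrrepresentableCondition (1 / 2) (normalizeColumns (X ω)) β}
  let B : Fin p × Fin p → Set Ω := fun q => {ω | Distorts ε (X ω) (polarizationVector q)}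
  have hcover : Set.univ ⊆ I ∪ ⋃ q, B q := by
    intro ω _
    by_cases hω : ω ∈ ⋃ q, B q
    · exact Or.inr hω
    · left
      obtain ⟨h1, h2⟩ := coherence_normalizeColumns_le (A := X ω) hn hε hε1
        fun q hq => hω (Set.mem_iUnion.2 ⟨q, hq⟩)
      exact irrepresentableCondition_of_coherence_le (by positivity) h1 h2 hcoh
  have hB : P.real (⋃ q, B q) ≤ 4 * (p : ℝ) ^ 2 * Real.exp (-(n : ℝ) ^ (1 / 2 : ℝ)) :=
    calc P.real (⋃ q, B q) ≤ ∑ q, P.real (B q) := measureReal_iUnion_fintype_le _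
      _ ≤ ∑ _q : Fin p × Fin p, 4 * Real.exp (-(n : ℝ) ^ (1 / 2 : ℝ)) :=
          Finset.sum_le_sum fun q _ =>
            (hX.measureReal_distorts_le hn hε (by linarith) (polarizationVector_ne_zero q)).trans
              (by linarith)
      _ = 4 * (p : ℝ) ^ 2 * Real.exp (-(n : ℝ) ^ (1 / 2 : ℝ)) := by
          simp
          ring
  -- Subadditivity of the outer measure suffices, so `I` need not be measurable.
  have h1 : 1 ≤ P.real (I ∪ ⋃ q, B q) := by
    rw [← probReal_univ (μ := P)]
    exact measureReal_mono hcover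
  linarith [measureReal_union_le (μ := P) I (⋃ q, B q)]
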